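/- Let $n\ge 1$, let $\langle z,w\rangle = w^*Hz$ be the Hermitian form of signature $(n,1)$ on $\mathbb C^{n+1}$ given by $\langle z,w\rangle=\bar w_{n+1}z_1+\bar w_2z_2+\dots+\bar w_nz_n+\bar w_1z_{n+1}$, let $\mathrm{SU}(n,1)$ be the group of complex matrices of determinant $1$ preserving it, and let $\overline{\mathbf H}$ be the closure of complex hyperbolic space, i.e. the set of points of $\mathbb P(\mathbb C^{n+1})$ with $\langle z,z\rangle\le 0$. Arguments of complex numbers are taken in $(-\pi,\pi]$. *Eigenframes and associated points.* Let $A\in\mathrm{SU}(n,1)$ be semisimple (diagonalizable). (1) If $A$ is hyperbolic (it has an eigenvalue of modulus $>1$), an eigenframe of $A$ consists of eigenvectors $a,x_1,\dots,x_{n-1},r$ of $A$ such that the eigenvalue of $a$ has modulus $>1$, $\langle a,a\rangle=\langle r,r\rangle=0$, $\langle a,r\rangle=1$, $\langle x_l,x_m\rangle=\delta_{lm}$, $\langle a,x_l\rangle=\langle r,x_l\rangle=0$, and the eigenvalues of $x_1,\dots,x_{n-1}$ (which have modulus $1$) are listed by non-decreasing argument. The associated points are the classes in $\overline{\mathbf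 H}$ of $a$, $(a-r)/\sqrt2+x_l$ ($1\le l\le n-1$), and $r$. The type of $A$ is "hyperbolic". (2) Otherwise $A$ is elliptic, and an eigenframe of $A$ consists of eigenvectors $x_1,\dots,x_{n+1}$ of $A$, pairwise orthogonal, with $\langle x_1,x_1\rangle=-1$ and $\langle x_j,x_j\rangle=1$ for $j\ge2$, such that the vectors with the same eigenvalue as $x_1$ come first and the eigenvalues of the remaining ones are listed by non-decreasing argument. The associated points are the classes in $\overline{\mathbf H}$ of $x_1$ and $\sqrt2\,x_1+x_j$ ($2\le j\le n+1$). The type of $A$ is the number of eigenvalues of $A$, counted with multiplicity, whose argument is smaller than that of the eigenvalue of $x_1$ (the position of the eigenvalue of negative type). *Canonical orbit.* For semisimple $A,B\in\mathrm{SU}(n,1)$, an eigenframe of $A$ and an eigenframe of $B$ give an ordered $(2n+2)$-tuple of points of $\overline{\mathbf H}$ (repetitions allowed), and hence a point of the space of $\mathrm{SU}(n,1)$-congruence classes of such tuples. The canonical orbit of $(A,B)$ is the set of all congruence classes obtained in this way when the eigenframes of $A$ and of $B$ vary (one orbit under independent changes of the eigenframes of $A$ and $B$), together with the types of $A$ and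 $B$. **Statement.** Let $\mathrm F_2=\langle x,y\rangle$ be the free group of rank two and let $\rho,\rho':\mathrm F_2\to\mathrm{SU}(n,1)$ be representations such that $\rho(x),\rho(y),\rho'(x),\rho'(y)$ are semisimple. Then $\rho$ and $\rho'$ define the same point of $\mathrm{Hom}(\mathrm F_2,\mathrm{SU}(n,1))/\mathrm{SU}(n,1)$ if and only if $$\mathrm{Tr}(\rho(x)^i)=\mathrm{Tr}(\rho'(x)^i),\qquad \mathrm{Tr}(\rho(y)^i)=\mathrm{Tr}(\rho'(y)^i)\qquad\text{for all }1\le i\le\lfloor (n+1)/2\rfloor,$$ and the canonical orbits of $(\rho(x),\rho(y))$ and of $(\rho'(x),\rho'(y))$ are equal. -/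

import Mathlib

open scoped Matrix LinearAlgebra.Projectivization

noncomputable section

namespace ComplexHyperbolic

/-! ### The Hermitian space of signature `(n,1)`, the group `SU(n,1)` and hyperbolic space -/

/-- The matrix of the Hermitian form of the Siegel domain model:
`1` in the two off-diagonal corners, the identity matrix in the middle, `0` elsewhere.
It has signature `(n,1)` as soon as `1 ≤ n`. -/
def siegelForm (n : ℕ) : Matrix (Fin (n + 1)) (Fin (n + 1)) ℂ :=
  Matrix.of fun i j =>
    if i = 0 then (if j = Fin.last n then 1 else 0)
    else if i = Fin.last n then (if j = 0 then 1 else 0)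
    else if i = j then 1 else 0

/-- The Hermitian form `⟨z, w⟩ = w* H z`. -/
def herm (n : ℕ) (z w : Fin (n + 1) → ℂ) : ℂ :=
  star w ⬝ᵥ (siegelForm n *ᵥ z)

/-- `SU(n,1)`: the complex matrices of determinant `1` preserving the Hermitian form. -/
def SU (n : ℕ) : Subgroup (Matrix.SpecialLinearGroup (Fin (n + 1)) ℂ) where
  carrier := {A | (A : Matrix (Fin (n + 1)) (Fin (n + 1)) ℂ)ᴴ * siegelForm n *
    (A : Matrix (Fin (n + 1)) (Fin (n + 1)) ℂ) = siegelForm n}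
  one_mem' := by simp
  mul_mem' := by
    intro A B hA hB
    simp only [Set.mem_ofPred_eq, Matrix.SpecialLinearGroup.coe_mul,
      Matrix.conjTranspose_mul] at *
    calc _ = (B : Matrix (Fin (n + 1)) (Fin (n + 1)) ℂ)ᴴ *
          ((A : Matrix (Fin (n + 1)) (Fin (n + 1)) ℂ)ᴴ * siegelForm n *
            (A : Matrix (Fin (n + 1)) (Fin (n + 1)) ℂ)) *
          (B : Matrix (Fin (n + 1)) (Fin (n + 1)) ℂ) := by simp only [Matrix.mul_assoc]
      _ = _ := by rw [hA, hB]
  inv_mem' := by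
    intro A hA
    simp only [Set.mem_ofPred_eq] at *
    have h1 : (A : Matrix (Fin (n + 1)) (Fin (n + 1)) ℂ) *
        ((A⁻¹ : Matrix.SpecialLinearGroup (Fin (n + 1)) ℂ) :
          Matrix (Fin (n + 1)) (Fin (n + 1)) ℂ) = 1 := by
      rw [← Matrix.SpecialLinearGroup.coe_mul, mul_inv_cancel,
        Matrix.SpecialLinearGroup.coe_one]
    have h2 := congrArg Matrix.conjTranspose h1
    rw [Matrix.conjTranspose_mul, Matrix.conjTranspose_one] at h2
    set B := ((A⁻¹ : Matrix.SpecialLinearGroup (Fin (n + 1)) ℂ) :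
          Matrix (Fin (n + 1)) (Fin (n + 1)) ℂ)
    set M := (A : Matrix (Fin (n + 1)) (Fin (n + 1)) ℂ)
    calc Bᴴ * siegelForm n * B = Bᴴ * (Mᴴ * siegelForm n * M) * B := by rw [hA]
      _ = (Bᴴ * Mᴴ) * siegelForm n * (M * B) := by simp only [Matrix.mul_assoc]
      _ = siegelForm n := by rw [h1, h2, Matrix.one_mul, Matrix.mul_one]

/-- The underlying matrix of an element of `SU(n,1)`. -/
def toMat {n : ℕ} (A : SU n) : Matrix (Fin (n + 1)) (Fin (n + 1)) ℂ :=
  ((A : Matrix.SpecialLinearGroup (Fin (n + 1)) ℂ) : Matrix (Fin (n + 1)) (Fin (n + 1)) ℂ)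

/-- Semisimple elements: the underlying linear endomorphism of `ℂ^{n+1}` is semisimple
(over `ℂ`: diagonalizable). -/
def IsSemisimpleElt {n : ℕ} (A : SU n) : Prop :=
  Module.End.IsSemisimple (Matrix.toLin' (toMat A))

/-- The closure of complex hyperbolic space inside `ℙ(ℂ^{n+1})`: the negative and the null
points. (The real part of `⟨z, z⟩` is `⟨z, z⟩` itself, and its sign does not depend on the lift.) -/
def ClosedHyp (n : ℕ) : Type :=
  {p : ℙ ℂ (Fin (n + 1) → ℂ) // (herm n p.rep p.rep).re ≤ 0}

/-! ### Representations of the free group of rank two -/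

/-- Conjugacy of representations of `F₂` in `SU(n,1)`. -/
def conjSetoid (n : ℕ) : Setoid (FreeGroup (Fin 2) →* SU n) where
  r ρ ρ' := ∃ g : SU n, ∀ w, ρ' w = g * ρ w * g⁻¹
  iseqv :=
    { refl := fun ρ => ⟨1, fun w => by simp⟩
      symm := by
        rintro ρ ρ' ⟨g, hg⟩
        exact ⟨g⁻¹, fun w => by rw [hg w]; group⟩
      trans := by
        rintro ρ ρ' ρ'' ⟨g, hg⟩ ⟨h, hh⟩
        exact ⟨h * g, fun w => by rw [hh w, hg w]; group⟩ }

/-- The space `Hom(F₂, SU(n,1)) / SU(n,1)`. -/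
def CharacterVariety (n : ℕ) : Type := Quotient (conjSetoid n)

/-- The point of `Hom(F₂, SU(n,1)) / SU(n,1)` given by a representation. -/
def charClass {n : ℕ} (ρ : FreeGroup (Fin 2) →* SU n) : CharacterVariety n :=
  Quotient.mk (conjSetoid n) ρ

/-- Both generators have semisimple image. -/
def IsSemisimpleRep {n : ℕ} (ρ : FreeGroup (Fin 2) →* SU n) : Prop :=
  IsSemisimpleElt (ρ (FreeGroup.of 0)) ∧ IsSemisimpleElt (ρ (FreeGroup.of 1))

/-! ### Eigenframes and associated points -/

/-- `F = (a, x₁, …, x_{n-1}, r)` is an orthonormal eigenframe of a hyperbolic `A`, with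
eigenvalues `ev`: the vectors `a = F 0`, `r = F (last)` are null with `⟨a, r⟩ = 1`, the others are
orthonormal and orthogonal to `a, r` (the Gram matrix is `siegelForm n`); `a` spans the attracting
fixed point; the positive eigenvectors are listed by increasing argument of the eigenvalue. -/
structure IsHyperbolicFrame {n : ℕ} (A : SU n) (ev : Fin (n + 1) → ℂ)
    (F : Fin (n + 1) → Fin (n + 1) → ℂ) : Prop where
  gram : ∀ i j, herm n (F i) (F j) = siegelForm n i j
  eigen : ∀ i, toMat A *ᵥ F i = ev i • F i
  attracting : 1 < ‖ev 0‖
  sorted : ∀ i j, 0 < i → i ≤ j → j < Fin.last n → (ev i).arg ≤ (ev j).arg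

/-- `F = (x₁, …, x_{n+1})` is an orthonormal eigenframe of an elliptic `A`, with eigenvalues `ev`:
`x₁ = F 0` is negative, the others are positive. The eigenspace of the negative eigenvalue `ev 0`
is listed first, then the other eigenspaces by increasing argument of the eigenvalue. -/
structure IsEllipticFrame {n : ℕ} (A : SU n) (ev : Fin (n + 1) → ℂ)
    (F : Fin (n + 1) → Fin (n + 1) → ℂ) : Prop where
  gram : ∀ i j, herm n (F i) (F j) = if i = j then (if i = 0 then -1 else 1) else 0
  eigen : ∀ i, toMat A *ᵥ F i = ev i • F i
  negative_first : ∀ i j, i ≤ j → ev j = ev 0 → ev i = ev 0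
  sorted : ∀ i j, i ≤ j → ev i ≠ ev 0 → (ev i).arg ≤ (ev j).arg

/-- Lifts of the associated points of a hyperbolic eigenframe `(a, x₁, …, x_{n-1}, r)`:
`a`, `(a - r)/√2 + x_l`, `r`. -/
def hyperbolicLift {n : ℕ} (F : Fin (n + 1) → Fin (n + 1) → ℂ) (i : Fin (n + 1)) :
    Fin (n + 1) → ℂ :=
  if i = 0 then F 0
  else if i = Fin.last n then F (Fin.last n)
  else (((Real.sqrt 2)⁻¹ : ℝ) : ℂ) • (F 0 - F (Fin.last n)) + F i

/-- Lifts of the associated points of an elliptic eigenframe `(x₁, …, x_{n+1})`: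
`x₁`, `√2 x₁ + x_j`. -/
def ellipticLift {n : ℕ} (F : Fin (n + 1) → Fin (n + 1) → ℂ) (i : Fin (n + 1)) :
    Fin (n + 1) → ℂ :=
  if i = 0 then F 0 else ((Real.sqrt 2 : ℝ) : ℂ) • F 0 + F i

/-- The position of the negative eigenvalue `ev 0` of an elliptic element in the list of all its
eigenvalues (with multiplicity) ordered by argument. -/
def negativePosition {n : ℕ} (ev : Fin (n + 1) → ℂ) : ℕ :=
  (Finset.univ.filter fun i => (ev i).arg < (ev 0).arg).card

/-- `p` is a set of associated points of `A`, that is, it comes from some orthonormal eigenframe of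
`A`. The label `t` is the type of `A`: `none` if `A` is hyperbolic, `some k` if `A` is elliptic and
its negative eigenvalue has position `k`. -/
def IsAssociated {n : ℕ} (A : SU n) (t : Option ℕ) (p : Fin (n + 1) → ClosedHyp n) : Prop :=
  (∃ ev F, IsHyperbolicFrame A ev F ∧ t = none ∧
    ∀ i, (p i).1.submodule = Submodule.span ℂ {hyperbolicLift F i}) ∨
  (∃ ev F, IsEllipticFrame A ev F ∧ t = some (negativePosition ev) ∧
    ∀ i, (p i).1.submodule = Submodule.span ℂ {ellipticLift F i})

/-! ### Canonical orbits -/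

/-- `SU(n,1)`-congruence of pairs of `(n+1)`-tuples of points of the closure of hyperbolic space. -/
def congSetoid (n : ℕ) :
    Setoid ((Fin (n + 1) → ClosedHyp n) × (Fin (n + 1) → ClosedHyp n)) where
  r P Q := ∃ g : SU n, (∀ i, g • (P.1 i).1 = (Q.1 i).1) ∧ (∀ i, g • (P.2 i).1 = (Q.2 i).1)
  iseqv :=
    { refl := fun P => ⟨1, by simp⟩
      symm := by
        rintro P Q ⟨g, h1, h2⟩
        exact ⟨g⁻¹, fun i => by rw [← h1 i, inv_smul_smul], fun i => by
          rw [← h2 i, inv_smul_smul]⟩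
      trans := by
        rintro P Q R ⟨g, h1, h2⟩ ⟨k, h3, h4⟩
        exact ⟨k * g, fun i => by rw [mul_smul, h1 i, h3 i], fun i => by
          rw [mul_smul, h2 i, h4 i]⟩ }

/-- Congruence classes of ordered `(2n+2)`-tuples of points of the closure of hyperbolic space
(repetitions are allowed; the pattern of repetitions is part of the class). -/
def ConfigSpace (n : ℕ) : Type := Quotient (congSetoid n)

/-- The canonical orbit of the pair `(A, B)`: the classes of all tuples of associated points
obtained from eigenframes of `A` and `B`, each with the types of `A` and `B`. Two eigenframes of
the same element (for the same listing of its eigenspaces) differ by a change of eigenframe, so this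
is a single orbit under the group of changes of eigenframes of `A` and of `B`. -/
def canonicalOrbit {n : ℕ} (A B : SU n) : Set (Option ℕ × Option ℕ × ConfigSpace n) :=
  {c | ∃ s t p q, IsAssociated A s p ∧ IsAssociated B t q ∧
    c = (s, t, Quotient.mk (congSetoid n) (p, q))}

end ComplexHyperbolic

end

namespace ComplexHyperbolic

variable {n : ℕ}

/-! A diagonalizable matrix is determined by its eigenlines together with the eigenvalue on each of
them. The traces and the type supply the eigenvalues; the associated points supply the eigenlines.

Eigenvalues. Since `A⁻¹ = H A* H` and `det A = 1`, the characteristic polynomial is, up to sign, the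
conjugate of its own reversal. Half of the power traces give half of the coefficients by Newton's
identities, and this symmetry gives the others (`eigenvalues_eq_of_traces`). It remains to know
which eigenvalue belongs to which frame vector. For hyperbolic elements moduli and arguments decide;
for elliptic ones the type singles out the negative eigenvalue and arguments sort the rest
(`IsHyperbolicFrame.eigenvalues_unique`, `IsEllipticFrame.eigenvalues_unique`).

Eigenlines. Positive eigenvectors are not points of the closed hyperbolic space, so they are encoded
by non-positive combinations with the remaining frame vectors. An isometry matching these
combinations also matches the frame lines, because it preserves orthogonal complements
(`IsEllipticFrame.exists_smul`, `IsHyperbolicFrame.exists_smul`). Hence any `g` carrying associated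
points of `A` to those of `A'` satisfies `A' = g A g⁻¹` (`IsAssociated.eq_conj`).

A congruence of the pairs of tuples provides one `g` serving both generators. Semisimple elements do
have eigenframes (`exists_isAssociated`), so the orbits are nonempty and equality of orbits yields
such a `g`. Conversely, conjugation transports eigenframes and preserves traces. -/

theorem smul_eq_toMat_mulVec (g : SU n) (v : Fin (n + 1) → ℂ) : g • v = toMat g *ᵥ v := rfl

/-! ### Sesquilinearity, nondegeneracy and invariance of the form -/

theorem herm_add_left (z z' w : Fin (n + 1) → ℂ) :
    herm n (z + z') w = herm n z w + herm n z' w := by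
  simp [herm, Matrix.mulVec_add]

theorem herm_smul_left (c : ℂ) (z w : Fin (n + 1) → ℂ) :
    herm n (c • z) w = c * herm n z w := by
  simp [herm, Matrix.mulVec_smul]

theorem herm_smul_right (c : ℂ) (z w : Fin (n + 1) → ℂ) :
    herm n z (c • w) = star c * herm n z w := by
  simp [herm]

theorem herm_add_right (z w w' : Fin (n + 1) → ℂ) :
    herm n z (w + w') = herm n z w + herm n z w' := by
  simp [herm, add_dotProduct]

/-- The Hermitian form with a fixed second argument, as a linear functional. -/
def hermLeft (w : Fin (n + 1) → ℂ) : (Fin (n + 1) → ℂ) →ₗ[ℂ] ℂ where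
  toFun z := herm n z w
  map_add' z z' := herm_add_left z z' w
  map_smul' c z := herm_smul_left c z w

@[simp] theorem hermLeft_apply (z w : Fin (n + 1) → ℂ) : hermLeft w z = herm n z w := rfl

theorem herm_sub_left (z z' w : Fin (n + 1) → ℂ) :
    herm n (z - z') w = herm n z w - herm n z' w :=
  map_sub (hermLeft w) z z'

theorem siegelForm_isHermitian : (siegelForm n)ᴴ = siegelForm n := by
  ext i j
  simp only [siegelForm, Matrix.conjTranspose_apply, Matrix.of_apply]
  split_ifs <;> first | exact star_one ℂ | exact star_zero ℂ | (exfalso; grind)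

theorem star_herm (z w : Fin (n + 1) → ℂ) : star (herm n z w) = herm n w z := by
  unfold herm
  rw [Matrix.star_dotProduct, star_star, Matrix.star_mulVec, siegelForm_isHermitian,
    Matrix.dotProduct_mulVec]

theorem herm_eq_zero_comm {z w : Fin (n + 1) → ℂ} : herm n z w = 0 ↔ herm n w z = 0 := by
  rw [← star_herm w z, star_eq_zero]

theorem herm_sub_right (z w w' : Fin (n + 1) → ℂ) :
    herm n z (w - w') = herm n z w - herm n z w' := by
  rw [← star_herm, herm_sub_left, star_sub, star_herm, star_herm]

theorem herm_self_eq_re (z : Fin (n + 1) → ℂ) : herm n z z = ((herm n z z).re : ℂ) := by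
  have h := star_herm z z
  exact (Complex.conj_eq_iff_real.mp h).elim fun r hr => by rw [hr, Complex.ofReal_re]

theorem herm_smul_smul_self (c : ℂ) (z : Fin (n + 1) → ℂ) :
    (herm n (c • z) (c • z)).re = ‖c‖ ^ 2 * (herm n z z).re := by
  rw [herm_smul_left, herm_smul_right, ← mul_assoc, herm_self_eq_re z]
  have : c * star c = ((‖c‖ ^ 2 : ℝ) : ℂ) := by
    simpa using Complex.mul_conj' c
  rw [this, ← Complex.ofReal_mul, Complex.ofReal_re, Complex.ofReal_re]

theorem siegelForm_mulVec (hn : 1 ≤ n) (z : Fin (n + 1) → ℂ) (i : Fin (n + 1)) :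
    (siegelForm n *ᵥ z) i =
      if i = 0 then z (Fin.last n) else if i = Fin.last n then z 0 else z i := by
  have : (0 : Fin (n + 1)) ≠ Fin.last n := by
    simp [Fin.ext_iff]; omega
  simp only [siegelForm, Matrix.mulVec, dotProduct, Matrix.of_apply]
  split_ifs <;> simp

theorem siegelForm_mul_self (hn : 1 ≤ n) : siegelForm n * siegelForm n = 1 := by
  have h0 : (0 : Fin (n + 1)) ≠ Fin.last n := by
    simp [Fin.ext_iff]; omega
  apply Matrix.toLin'.injective
  ext1 i
  ext j
  simp only [LinearMap.comp_apply, Matrix.toLin'_apply, ← Matrix.mulVec_mulVec,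
    siegelForm_mulVec hn, Matrix.one_mulVec]
  split_ifs <;> simp_all

-- Testing against `w = H z` gives the standard squared norm of `H z`, and `H` is an involution.
open scoped ComplexOrder in
theorem eq_zero_of_herm_eq_zero (hn : 1 ≤ n) {z : Fin (n + 1) → ℂ}
    (h : ∀ w, herm n z w = 0) : z = 0 := by
  have h1 := h (siegelForm n *ᵥ z)
  rw [herm] at h1
  replace h1 : siegelForm n *ᵥ z = 0 := dotProduct_star_self_eq_zero.mp h1
  rw [← Matrix.one_mulVec z, ← siegelForm_mul_self hn, ← Matrix.mulVec_mulVec, h1,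
    Matrix.mulVec_zero]

theorem toMat_conjTranspose_mul (A : SU n) : (toMat A)ᴴ * siegelForm n * toMat A = siegelForm n :=
  A.2

theorem herm_toMat_mulVec (A : SU n) (z w : Fin (n + 1) → ℂ) :
    herm n (toMat A *ᵥ z) (toMat A *ᵥ w) = herm n z w := by
  rw [herm, Matrix.star_mulVec, ← Matrix.dotProduct_mulVec, Matrix.mulVec_mulVec,
    Matrix.mulVec_mulVec, toMat_conjTranspose_mul, herm]

theorem toMat_mul (A B : SU n) : toMat (A * B) = toMat A * toMat B := rfl

theorem toMat_one : toMat (1 : SU n) = 1 := rfl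

theorem toMat_inv_mul (A : SU n) : toMat A⁻¹ * toMat A = 1 := by
  rw [← toMat_mul, inv_mul_cancel, toMat_one]

theorem toMat_injective : Function.Injective (toMat : SU n → _) :=
  Subtype.val_injective.comp Subtype.val_injective

theorem det_toMat (A : SU n) : (toMat A).det = 1 := A.1.2

/-- Eigenvalues of non-orthogonal eigenvectors are inverse up to conjugation. -/
theorem mul_star_eq_one_of_herm_ne_zero {A : SU n} {z w : Fin (n + 1) → ℂ} {a b : ℂ}
    (hz : toMat A *ᵥ z = a • z) (hw : toMat A *ᵥ w = b • w) (h : herm n z w ≠ 0) :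
    a * star b = 1 := by
  have h1 := herm_toMat_mulVec A z w
  rw [hz, hw, herm_smul_left, herm_smul_right, ← mul_assoc] at h1
  exact mul_right_cancel₀ h (by rw [h1, one_mul])

theorem norm_eq_one_of_mul_star {a : ℂ} (h : a * star a = 1) : ‖a‖ = 1 := by
  have := congrArg norm h
  rw [norm_mul, norm_star, norm_one] at this
  nlinarith [norm_nonneg a]

/-! ### Consequences of the signature `(n,1)` -/

theorem zero_ne_last (hn : 1 ≤ n) : (0 : Fin (n + 1)) ≠ Fin.last n := by
  simp [Fin.ext_iff]; omega

/-- The form is positive definite on the hyperplane `z₁ = z_{n+1}`. -/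
theorem eq_zero_of_herm_self_nonpos (hn : 1 ≤ n) {z : Fin (n + 1) → ℂ}
    (hz : z 0 = z (Fin.last n)) (h : (herm n z z).re ≤ 0) : z = 0 := by
  -- `H` swaps the two end coordinates, so it fixes `z` and the form at `z` is the standard squared
  -- norm.
  have h1 : siegelForm n *ᵥ z = z := by
    ext i
    rw [siegelForm_mulVec hn]
    split_ifs <;> simp_all
  rw [herm, h1, dotProduct] at h
  simp only [Pi.star_apply, Complex.re_sum] at h
  have h2 : ∀ i, (star (z i) * z i).re = ‖z i‖ ^ 2 := fun i => by
    have : star (z i) * z i = ((‖z i‖ ^ 2 : ℝ) : ℂ) := by simpa using Complex.conj_mul' (z i)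
    rw [this, Complex.ofReal_re]
  simp only [h2] at h
  have h3 := (Finset.sum_eq_zero_iff_of_nonneg (fun i _ => by positivity)).mp
    (le_antisymm h (Finset.sum_nonneg fun i _ => by positivity))
  ext i
  simpa using h3 i (Finset.mem_univ i)

/-- Two orthogonal vectors of non-positive type are proportional. -/
theorem exists_smul_eq_of_nonpos (hn : 1 ≤ n) {v w : Fin (n + 1) → ℂ} (hv : v ≠ 0)
    (hvv : (herm n v v).re ≤ 0) (hww : (herm n w w).re ≤ 0) (hvw : herm n v w = 0) :
    ∃ c : ℂ, w = c • v := by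
  set α := v 0 - v (Fin.last n) with hα
  set β := w 0 - w (Fin.last n) with hβ
  have hα0 : α ≠ 0 := fun h => hv (eq_zero_of_herm_self_nonpos hn (sub_eq_zero.mp h) hvv)
  -- This combination is chosen to lie in the positive definite hyperplane `z₁ = z_{n+1}`. By
  -- orthogonality its square is `|α|²⟨w,w⟩ + |β|²⟨v,v⟩ ≤ 0`, so it vanishes.
  have hz : α • w - β • v = 0 := by
    apply eq_zero_of_herm_self_nonpos hn
    · simp [hα, hβ]; ring
    · rw [herm_sub_left, herm_sub_right, herm_sub_right, herm_smul_left α w (β • v),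
        herm_smul_left β v (α • w), herm_smul_right β, herm_smul_right α v, hvw,
        herm_eq_zero_comm.mp hvw]
      simp only [mul_zero, sub_zero, zero_sub, sub_neg_eq_add, Complex.add_re,
        herm_smul_smul_self]
      have := sq_nonneg ‖α‖
      have := sq_nonneg ‖β‖
      nlinarith
  refine ⟨α⁻¹ * β, ?_⟩
  rw [mul_smul, ← sub_eq_zero.mp hz, inv_smul_smul₀ hα0]

/-- The orthogonal complement of a negative vector is positive definite. -/
theorem herm_self_pos_of_orthogonal_negative (hn : 1 ≤ n) {v w : Fin (n + 1) → ℂ}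
    (hv : (herm n v v).re < 0) (hw : w ≠ 0) (h : herm n w v = 0) : 0 < (herm n w w).re := by
  by_contra! hww
  have hv0 : v ≠ 0 := by rintro rfl; simp [herm] at hv
  obtain ⟨c, rfl⟩ := exists_smul_eq_of_nonpos hn hv0 hv.le hww (herm_eq_zero_comm.mp h)
  rw [herm_smul_left] at h
  rcases mul_eq_zero.mp h with h | h
  · simp [h] at hw
  · simp [h] at hv

/-- The orthogonal complement of a hyperbolic pair is positive definite. -/
theorem herm_self_pos_of_orthogonal_pair (hn : 1 ≤ n) {a r w : Fin (n + 1) → ℂ}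
    (ha : herm n a a = 0) (har : herm n a r = 1) (hw : w ≠ 0)
    (h : herm n w a = 0) (h' : herm n w r = 0) : 0 < (herm n w w).re := by
  by_contra! hww
  have ha0 : a ≠ 0 := by rintro rfl; simp [herm] at har
  obtain ⟨c, rfl⟩ := exists_smul_eq_of_nonpos hn ha0 (by simp [ha]) hww (herm_eq_zero_comm.mp h)
  rw [herm_smul_left, har, mul_one] at h'
  simp [h'] at hw

/-! ### Existence of eigenframes -/

theorem toMat_mulVec_injective (A : SU n) : Function.Injective (toMat A *ᵥ ·) := fun z w h => by
  have := congrArg (toMat A⁻¹ *ᵥ ·) h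
  simpa [Matrix.mulVec_mulVec, toMat_inv_mul] using this

/-- This makes the orthogonal complement of an eigenvector invariant, so that further eigenvectors
can be found inside it. The case `b = 0` forces `w = 0` by invertibility. -/
theorem herm_toMat_mulVec_eq_zero (A : SU n) {z w : Fin (n + 1) → ℂ} {b : ℂ}
    (hw : toMat A *ᵥ w = b • w) (h : herm n z w = 0) : herm n (toMat A *ᵥ z) w = 0 := by
  have h1 := herm_toMat_mulVec A z w
  rw [hw, herm_smul_right, h] at h1
  rcases mul_eq_zero.mp h1 with hb | h2
  · rw [star_eq_zero.mp hb, zero_smul, ← Matrix.mulVec_zero (toMat A)] at hw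
    rw [toMat_mulVec_injective A hw]
    simp [herm]
  · exact h2

/-- Fewer than `n + 1` eigenvectors admit a further eigenvector orthogonal to all of them. -/
theorem exists_eigenvector_orthogonal (A : SU n) {ι : Type*} [Fintype ι]
    (hι : Fintype.card ι < n + 1) (u : ι → Fin (n + 1) → ℂ) (e : ι → ℂ)
    (hu : ∀ i, toMat A *ᵥ u i = e i • u i) :
    ∃ w ≠ 0, (∃ μ : ℂ, toMat A *ᵥ w = μ • w) ∧ ∀ i, herm n w (u i) = 0 := by
  let W := LinearMap.ker (LinearMap.pi fun i => hermLeft (u i))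
  have hW : ∀ w, w ∈ W ↔ ∀ i, herm n w (u i) = 0 := fun w => by
    simp [W, funext_iff]
  -- Fewer than `n + 1` linear conditions leave a nonzero invariant subspace, on which the
  -- restriction has an eigenvalue over `ℂ`.
  have hne : W ≠ ⊥ := LinearMap.ker_ne_bot_of_finrank_lt (by simpa using hι)
  have hinv : ∀ w ∈ W, Matrix.toLin' (toMat A) w ∈ W := fun w hw => by
    rw [hW] at hw ⊢
    exact fun i => herm_toMat_mulVec_eq_zero A (hu i) (hw i)
  have : Nontrivial W := Submodule.nontrivial_iff_ne_bot.mpr hne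
  obtain ⟨μ, hμ⟩ := Module.End.exists_eigenvalue ((Matrix.toLin' (toMat A)).restrict hinv)
  obtain ⟨w, hw⟩ := hμ.exists_hasEigenvector
  refine ⟨w, by simpa using hw.2, ⟨μ, ?_⟩, (hW w).mp w.2⟩
  have := congrArg Subtype.val hw.apply_eq_smul
  simpa using this

theorem exists_unit_smul {w : Fin (n + 1) → ℂ} (hw : 0 < (herm n w w).re) :
    ∃ c : ℂ, herm n (c • w) (c • w) = 1 := by
  refine ⟨((√(herm n w w).re)⁻¹ : ℝ), ?_⟩
  rw [herm_self_eq_re, herm_smul_smul_self, Complex.norm_real, Real.norm_eq_abs, sq_abs, inv_pow,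
    Real.sq_sqrt hw.le, inv_mul_cancel₀ hw.ne', Complex.ofReal_one]

theorem exists_neg_unit_smul {w : Fin (n + 1) → ℂ} (hw : (herm n w w).re < 0) :
    ∃ c : ℂ, herm n (c • w) (c • w) = -1 := by
  refine ⟨((√(-(herm n w w).re))⁻¹ : ℝ), ?_⟩
  rw [herm_self_eq_re, herm_smul_smul_self, Complex.norm_real, Real.norm_eq_abs, sq_abs, inv_pow,
    Real.sq_sqrt (by linarith), inv_neg, neg_mul, inv_mul_cancel₀ hw.ne, Complex.ofReal_neg,
    Complex.ofReal_one]

theorem smul_mulVec_eigen {A : SU n} {w : Fin (n + 1) → ℂ} {μ : ℂ}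
    (h : toMat A *ᵥ w = μ • w) (c : ℂ) : toMat A *ᵥ (c • w) = μ • c • w := by
  rw [Matrix.mulVec_smul, h, smul_comm]

/-- Orthonormal eigenvectors in a positive definite orthogonal complement of eigenvectors. -/
theorem exists_orthonormal_eigenvectors (A : SU n) {m : ℕ} (s : Fin m → Fin (n + 1) → ℂ)
    (e : Fin m → ℂ) (hs : ∀ i, toMat A *ᵥ s i = e i • s i)
    (hpos : ∀ w ≠ 0, (∀ i, herm n w (s i) = 0) → 0 < (herm n w w).re) (k : ℕ) (hk : m + k ≤ n + 1) :
    ∃ (f : Fin k → Fin (n + 1) → ℂ) (μ : Fin k → ℂ), (∀ i, toMat A *ᵥ f i = μ i • f i) ∧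
      (∀ i j, herm n (f i) (f j) = if i = j then 1 else 0) ∧ ∀ i j, herm n (f i) (s j) = 0 := by
  induction k with
  | zero => exact ⟨0, 0, fun i => i.elim0, fun i => i.elim0, fun i => i.elim0⟩
  | succ k ih =>
    obtain ⟨f, μ, hf, horth, hfs⟩ := ih (by omega)
    -- The new vector must be orthogonal both to the fixed system `s` and to the `f` already built;
    -- positivity then allows normalization.
    obtain ⟨w, hw0, ⟨ν, hν⟩, hw⟩ := exists_eigenvector_orthogonal A (ι := Fin m ⊕ Fin k)
      (by simp; omega) (Sum.elim s f) (Sum.elim e μ) (by rintro (i | i) <;> simp [hs, hf])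
    obtain ⟨c, hc⟩ := exists_unit_smul (hpos w hw0 fun i => hw (Sum.inl i))
    have hwf : ∀ i, herm n (c • w) (f i) = 0 := fun i => by
      rw [herm_smul_left]
      simp [show herm n w (f i) = 0 from hw (Sum.inr i)]
    refine ⟨Fin.cons (c • w) f, Fin.cons ν μ, ?_, ?_, ?_⟩
    · exact Fin.cases (by simpa using smul_mulVec_eigen hν c) (by simpa using hf)
    · refine Fin.cases (Fin.cases (by simpa using hc) fun j => ?_)
        fun i => Fin.cases ?_ fun j => ?_
      · simpa [(Fin.succ_ne_zero j).symm] using hwf j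
      · simpa using herm_eq_zero_comm.mp (hwf i)
      · simpa using horth i j
    · refine Fin.cases (fun j => ?_) (by simpa using hfs)
      rw [Fin.cons_zero, herm_smul_left, show herm n w (s j) = 0 from hw (Sum.inl j), mul_zero]

/-- The eigenvectors of a semisimple element separate vectors. -/
theorem exists_eigenvector_herm_ne_zero (hn : 1 ≤ n) {A : SU n} (hA : IsSemisimpleElt A)
    {a : Fin (n + 1) → ℂ} (ha : a ≠ 0) :
    ∃ r, (∃ μ : ℂ, toMat A *ᵥ r = μ • r) ∧ herm n a r ≠ 0 := by
  by_contra! H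
  refine ha (eq_zero_of_herm_eq_zero hn fun w => herm_eq_zero_comm.mp ?_)
  -- Eigenspaces span, so a vector orthogonal to every eigenvector lies in the radical, which is
  -- zero.
  have hw : w ∈ ⨆ μ, Module.End.eigenspace (Matrix.toLin' (toMat A)) μ := by
    rw [Module.End.IsSemisimple.iSup_eigenspace_eq_top hA]; trivial
  have hle : ⨆ μ, Module.End.eigenspace (Matrix.toLin' (toMat A)) μ ≤ LinearMap.ker (hermLeft a) :=
    iSup_le fun μ r hr => herm_eq_zero_comm.mp
      (H r ⟨μ, by simpa using Module.End.mem_eigenspace_iff.mp hr⟩)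
  exact hle hw

theorem exists_negative_vector (hn : 1 ≤ n) : ∃ v, (herm n v v).re < 0 := by
  have h0 := zero_ne_last hn
  refine ⟨Pi.single 0 1 - Pi.single (Fin.last n) 1, ?_⟩
  have h : ∀ i j, herm n (Pi.single i 1) (Pi.single j 1) = siegelForm n j i := fun i j => by
    simp [herm]
  simp [herm_sub_left, herm_sub_right, h, siegelForm, h0, h0.symm]

/-- A semisimple element without eigenvalues of modulus `> 1` has a negative eigenvector. -/
theorem exists_negative_eigenvector (hn : 1 ≤ n) {A : SU n} (hA : IsSemisimpleElt A)
    (hell : ∀ (μ : ℂ) v, v ≠ 0 → toMat A *ᵥ v = μ • v → ‖μ‖ ≤ 1) :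
    ∃ v, (∃ μ : ℂ, toMat A *ᵥ v = μ • v) ∧ (herm n v v).re < 0 := by
  obtain ⟨v, hv⟩ := exists_negative_vector hn
  by_contra! H
  have hw : v ∈ ⨆ μ, Module.End.eigenspace (Matrix.toLin' (toMat A)) μ := by
    rw [Module.End.IsSemisimple.iSup_eigenspace_eq_top hA]; trivial
  obtain ⟨f, hf, rfl⟩ := (Submodule.mem_iSup_iff_exists_finsupp _ _).mp hw
  have hf' : ∀ μ, toMat A *ᵥ f μ = μ • f μ := fun μ => by
    simpa using Module.End.mem_eigenspace_iff.mp (hf μ)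
  -- Nonorthogonality gives `μ ν̄ = 1`; with both moduli at most `1` they equal `1`, whence `μ = ν`.
  have horth : ∀ μ ν, μ ≠ ν → herm n (f μ) (f ν) = 0 := fun μ ν hμν => by
    by_contra h
    have h1 := mul_star_eq_one_of_herm_ne_zero (hf' μ) (hf' ν) h
    have hμ := hell μ (f μ) (by intro h0; simp [h0, herm] at h) (hf' μ)
    have hν := hell ν (f ν) (by intro h0; simp [h0, herm] at h) (hf' ν)
    have h2 := congrArg norm h1
    rw [norm_mul, norm_star, norm_one] at h2
    have hν1 : ‖ν‖ = 1 := by nlinarith [norm_nonneg μ, norm_nonneg ν]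
    have h3 : ν * star ν = 1 := by
      simpa [hν1] using Complex.mul_conj' ν
    exact hμν (mul_right_cancel₀ (right_ne_zero_of_mul_eq_one h3) (h1.trans h3.symm))
  -- The eigencomponents are pairwise orthogonal, so `⟨v,v⟩` is the sum of their squares, all
  -- nonnegative if no eigenvector is negative.
  refine hv.not_ge ?_
  have hright : ∀ (z : Fin (n + 1) → ℂ) (s : Finset ℂ),
      herm n z (∑ μ ∈ s, f μ) = ∑ μ ∈ s, herm n z (f μ) := fun z s => by
    rw [← star_herm, ← hermLeft_apply, map_sum, star_sum]
    simp [star_herm]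
  rw [Finsupp.sum, hright, Complex.re_sum]
  refine Finset.sum_nonneg fun μ hμ => ?_
  rw [← hermLeft_apply, map_sum, Finset.sum_eq_single_of_mem μ hμ]
  · exact H (f μ) ⟨μ, hf' μ⟩
  · exact fun ν _ h => horth ν μ h

theorem exists_ellipticFrame (hn : 1 ≤ n) {A : SU n} (hA : IsSemisimpleElt A)
    (hell : ∀ (μ : ℂ) v, v ≠ 0 → toMat A *ᵥ v = μ • v → ‖μ‖ ≤ 1) :
    ∃ ev F, IsEllipticFrame A ev F := by
  obtain ⟨v, ⟨μ, hμ⟩, hv⟩ := exists_negative_eigenvector hn hA hell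
  obtain ⟨c, hc⟩ := exists_neg_unit_smul hv
  set x := c • v
  have hx : toMat A *ᵥ x = μ • x := smul_mulVec_eigen hμ c
  obtain ⟨f, ν, hf, horth, hfx⟩ := exists_orthonormal_eigenvectors A (fun _ : Fin 1 => x)
    (fun _ => μ) (fun _ => hx) (fun w hw h => herm_self_pos_of_orthogonal_negative hn
      (by simp [hc]) hw (h 0)) n (by omega)
  -- Any value below `-π` works: `-4` puts the eigenvalue `μ` of the negative vector before every
  -- argument, so one sort yields the required order.
  let key : ℂ → ℝ := fun z => if z = μ then -4 else z.arg
  have hkey : ∀ z, -4 ≤ key z ∧ (key z = -4 → z = μ) := fun z => by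
    have h1 := Complex.neg_pi_lt_arg z
    have h2 := Real.pi_lt_four
    by_cases hz : z = μ
    · simp [key, hz]
    · simp only [key, hz, if_false]
      exact ⟨by linarith, fun h => by linarith⟩
  let σ := Tuple.sort (key ∘ ν)
  have hσ : Monotone ((key ∘ ν) ∘ σ) := Tuple.monotone_sort _
  have hmono : Monotone fun i => key ((Fin.cons μ (ν ∘ σ) : Fin (n + 1) → ℂ) i) := by
    intro i j hij
    induction i using Fin.cases with
    | zero => simpa [key] using (hkey _).1
    | succ i =>
      induction j using Fin.cases with
      | zero => simp at hij
      | succ j => simpa using hσ (Fin.succ_le_succ_iff.mp hij)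
  have hneg : ∀ i j, i ≤ j → (Fin.cons μ (ν ∘ σ) : Fin (n + 1) → ℂ) j = μ →
      (Fin.cons μ (ν ∘ σ) : Fin (n + 1) → ℂ) i = μ := fun i j hij hj => by
    have h := hmono hij
    simp only [hj] at h
    refine (hkey _).2 (le_antisymm (h.trans ?_) (hkey _).1)
    simp [key]
  refine ⟨Fin.cons μ (ν ∘ σ), Fin.cons x (f ∘ σ), ?_, ?_, hneg, ?_⟩
  · refine Fin.cases (Fin.cases (by simpa using hc) fun j => ?_)
      fun i => Fin.cases ?_ fun j => ?_
    · simpa [(Fin.succ_ne_zero j).symm] using herm_eq_zero_comm.mp (hfx (σ j) 0)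
    · simpa using hfx (σ i) 0
    · simpa using horth (σ i) (σ j)
  · exact Fin.cases (by simpa using hx) fun i => by simpa using hf (σ i)
  · intro i j hij hi
    have h := hmono hij
    simp only [Fin.cons_zero] at hi
    simpa only [key, hi, mt (hneg i j hij) hi, if_false] using h

theorem exists_hyperbolicFrame (hn : 1 ≤ n) {A : SU n} (hA : IsSemisimpleElt A)
    {μ : ℂ} {a : Fin (n + 1) → ℂ} (ha0 : a ≠ 0) (ha : toMat A *ᵥ a = μ • a) (hμ : 1 < ‖μ‖) :
    ∃ ev F, IsHyperbolicFrame A ev F := by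
  obtain ⟨k, rfl⟩ : ∃ k, n = k + 1 := ⟨n - 1, by omega⟩
  obtain ⟨r, ⟨ν, hr⟩, har⟩ := exists_eigenvector_herm_ne_zero hn hA ha0
  have hμν := mul_star_eq_one_of_herm_ne_zero ha hr har
  have hν : ‖ν‖ < 1 := by
    have h2 := congrArg norm hμν
    rw [norm_mul, norm_star, norm_one] at h2
    nlinarith [norm_nonneg ν]
  -- A non-null eigenvector has an eigenvalue of modulus one.
  have hnull : ∀ {z : Fin (k + 1 + 1) → ℂ} {b : ℂ}, toMat A *ᵥ z = b • z → ‖b‖ ≠ 1 →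
      herm (k + 1) z z = 0 := fun hz hb => by
    by_contra h
    exact hb (norm_eq_one_of_mul_star (mul_star_eq_one_of_herm_ne_zero hz hz h))
  have haa := hnull ha hμ.ne'
  have hrr := hnull hr hν.ne
  -- Rescaling of `r` that gives `⟨a, s⟩ = 1`; the conjugate appears because the form is
  -- conjugate-linear in its second argument.
  obtain ⟨s, hs⟩ : ∃ s, s = (star (herm (k + 1) a r))⁻¹ • r := ⟨_, rfl⟩
  have hse : toMat A *ᵥ s = ν • s := hs ▸ smul_mulVec_eigen hr _
  have hss : herm (k + 1) s s = 0 := by rw [hs, herm_smul_left, herm_smul_right, hrr]; simp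
  have has : herm (k + 1) a s = 1 := by
    rw [hs, herm_smul_right, star_inv₀, star_star, inv_mul_cancel₀ har]
  have hsa : herm (k + 1) s a = 1 := by rw [← star_herm, has, star_one]
  obtain ⟨f, τ, hf, horth, hfs⟩ := exists_orthonormal_eigenvectors A ![a, s] ![μ, ν]
    (by intro i; fin_cases i <;> simp [ha, hse])
    (fun w hw h => herm_self_pos_of_orthogonal_pair hn haa has hw (h 0) (h 1)) k (by omega)
  have hfa : ∀ i, herm (k + 1) (f i) a = 0 := fun i => hfs i 0
  have hfs' : ∀ i, herm (k + 1) (f i) s = 0 := fun i => hfs i 1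
  have haf : ∀ i, herm (k + 1) a (f i) = 0 := fun i => herm_eq_zero_comm.mp (hfa i)
  have hsf : ∀ i, herm (k + 1) s (f i) = 0 := fun i => herm_eq_zero_comm.mp (hfs' i)
  let σ := Tuple.sort fun i => (τ i).arg
  have hσ : Monotone ((fun i => (τ i).arg) ∘ σ) := Tuple.monotone_sort _
  have hlast : Fin.last (k + 1) = (Fin.last k).succ := rfl
  refine ⟨Fin.cons μ (Fin.snoc (α := fun _ => ℂ) (τ ∘ σ) ν),
    Fin.cons a (Fin.snoc (α := fun _ => Fin (k + 1 + 1) → ℂ) (f ∘ σ) s), ?_, ?_, ?_, ?_⟩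
  · intro i j
    rw [siegelForm, Matrix.of_apply, hlast]
    induction i using Fin.cases with
    | zero =>
      induction j using Fin.cases with
      | zero => simp [haa]
      | succ j =>
        induction j using Fin.lastCases with
        | last => simp [has]
        | cast j => simp [haf, Fin.castSucc_ne_last]
    | succ i =>
      induction i using Fin.lastCases with
      | last =>
        induction j using Fin.cases with
        | zero => simp [hsa]
        | succ j =>
          induction j using Fin.lastCases with
          | last => simp [hss]
          | cast j => simp [hsf]
      | cast i =>
        induction j using Fin.cases with
        | zero => simp [hfa, Fin.castSucc_ne_last]
        | succ j =>
          induction j using Fin.lastCases with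
          | last => simp [hfs', Fin.castSucc_ne_last]
          | cast j => simp [horth, Fin.castSucc_ne_last]
  · refine Fin.cases (by simpa using ha) (Fin.lastCases ?_ fun i => ?_)
    · simpa using hse
    · simpa using hf (σ i)
  · simpa using hμ
  · intro i j hi hij hj
    rw [hlast] at hj
    obtain ⟨i, rfl⟩ := Fin.exists_succ_eq.mpr hi.ne'
    obtain ⟨j, rfl⟩ := Fin.exists_succ_eq.mpr (hi.trans_le hij).ne'
    obtain ⟨j, rfl⟩ := Fin.exists_castSucc_eq.mpr (Fin.succ_lt_succ_iff.mp hj).ne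
    obtain ⟨i, rfl⟩ := Fin.exists_castSucc_eq.mpr
      ((Fin.succ_le_succ_iff.mp hij).trans_lt (Fin.succ_lt_succ_iff.mp hj)).ne
    simpa using hσ (show i ≤ j by simpa using hij)

/-! ### Eigenvalues from power traces -/

/-- Newton's identities: the first `m` power sums determine the first `m` elementary symmetric
functions. -/
theorem esymm_eq_of_power_sums {N m : ℕ} {f g : Fin N → ℂ}
    (h : ∀ i, 1 ≤ i → i ≤ m → ∑ j, f j ^ i = ∑ j, g j ^ i) (k : ℕ) (hk : k ≤ m) :
    (Finset.univ.val.map f).esymm k = (Finset.univ.val.map g).esymm k := by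
  induction k using Nat.strong_induction_on with
  | _ k ih =>
    rcases Nat.eq_zero_or_pos k with rfl | hk0
    · simp [Finset.esymm_map_val, -Fin.univ_val_map]
    have newton : ∀ u : Fin N → ℂ, (k : ℂ) * (Finset.univ.val.map u).esymm k =
        (-1) ^ (k + 1) * ∑ a ∈ Finset.HasAntidiagonal.antidiagonal k with a.1 < k,
          (-1) ^ a.1 * (Finset.univ.val.map u).esymm a.1 * ∑ j, u j ^ a.2 := fun u => by
      have := congrArg (MvPolynomial.aeval u) (MvPolynomial.mul_esymm_eq_sum (Fin N) ℂ k)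
      simpa only [map_mul, map_natCast, map_pow, map_neg, map_one, map_sum,
        MvPolynomial.aeval_esymm_eq_multiset_esymm, MvPolynomial.psum, MvPolynomial.aeval_X]
        using this
    refine mul_left_cancel₀ (Nat.cast_ne_zero.mpr hk0.ne' : (k : ℂ) ≠ 0) ?_
    rw [newton, newton]
    congr 1
    refine Finset.sum_congr rfl fun a ha => ?_
    rw [Finset.mem_filter, Finset.HasAntidiagonal.mem_antidiagonal] at ha
    rw [ih a.1 ha.2 (by omega), h a.2 (by omega) (by omega)]

/-- The coefficients of the characteristic polynomial of an element of `SU(n,1)` are conjugate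
in pairs, up to sign. -/
theorem star_coeff_charpoly (hn : 1 ≤ n) (A : SU n) {k : ℕ} (hk : k ≤ n + 1) :
    star ((toMat A).charpoly.coeff k) = (-1) ^ (n + 1) * (toMat A).charpoly.coeff (n + 1 - k) := by
  have hdet := det_toMat A
  have hinv : (toMat A)⁻¹ = siegelForm n * (toMat A)ᴴ * siegelForm n := by
    refine Matrix.inv_eq_left_inv ?_
    rw [Matrix.mul_assoc (siegelForm n * _), Matrix.mul_assoc (siegelForm n),
      ← Matrix.mul_assoc _ _ (toMat A), toMat_conjTranspose_mul, siegelForm_mul_self hn]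
  have hunit : IsUnit (toMat A) := by
    rw [Matrix.isUnit_iff_isUnit_det, hdet]; exact isUnit_one
  have h1 := Matrix.charpoly_inv (toMat A) hunit
  -- `A⁻¹ = H A* H` is similar to `A*`, so its characteristic polynomial is the conjugate one.
  -- Comparison with the reversal formula for an inverse of determinant one gives the symmetry.
  have h2 : (toMat A)⁻¹.charpoly = (toMat A).charpoly.map (starRingEnd ℂ) := by
    rw [hinv, Matrix.charpoly_mul_comm, ← Matrix.mul_assoc, siegelForm_mul_self hn,
      Matrix.one_mul, ← Matrix.charpoly_map, ← Matrix.charpoly_transpose ((toMat A).map _)]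
    rfl
  rw [h2, hdet, Ring.inverse_one, Polynomial.C_1, mul_one, ← Matrix.reverse_charpoly] at h1
  have h3 := congrArg (Polynomial.coeff · k) h1
  have h4 : ((-1 : Polynomial ℂ) ^ (n + 1)) = Polynomial.C ((-1) ^ (n + 1)) := by simp
  simp only [Polynomial.coeff_map, Fintype.card_fin] at h3
  rw [h4, Polynomial.coeff_C_mul, Polynomial.coeff_reverse, Matrix.charpoly_natDegree_eq_dim,
    Fintype.card_fin, Polynomial.revAt_le hk] at h3
  exact h3

/-- The columns of a frame. -/
def frameMatrix (F : Fin (n + 1) → Fin (n + 1) → ℂ) : Matrix (Fin (n + 1)) (Fin (n + 1)) ℂ :=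
  (Matrix.of F)ᵀ

/-- With `P` the matrix of columns, `P* H P` is the transposed Gram matrix; when the Gram matrix is
an involution this exhibits a left inverse of `P`. -/
theorem isUnit_frameMatrix {F : Fin (n + 1) → Fin (n + 1) → ℂ}
    {G : Matrix (Fin (n + 1)) (Fin (n + 1)) ℂ} (hG : G * G = 1)
    (hF : ∀ i j, herm n (F i) (F j) = G i j) : IsUnit (frameMatrix F) := by
  have h : (frameMatrix F)ᴴ * siegelForm n * frameMatrix F = Gᵀ := by
    ext i j
    rw [Matrix.transpose_apply, ← hF, herm, Matrix.mul_assoc]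
    rfl
  refine isUnit_iff_exists_inv'.mpr ⟨Gᵀ * ((frameMatrix F)ᴴ * siegelForm n), ?_⟩
  rw [Matrix.mul_assoc, h, ← Matrix.transpose_mul, hG, Matrix.transpose_one]

theorem mul_frameMatrix_eq {M : Matrix (Fin (n + 1)) (Fin (n + 1)) ℂ}
    {F : Fin (n + 1) → Fin (n + 1) → ℂ} {ev : Fin (n + 1) → ℂ}
    (h : ∀ i, M *ᵥ F i = ev i • F i) :
    M * frameMatrix F = frameMatrix F * Matrix.diagonal ev := by
  ext i j
  rw [Matrix.mul_diagonal]
  rw [mul_comm]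
  exact congrFun (h j) i

theorem eq_of_mulVec_eq_on_frame {M M' : Matrix (Fin (n + 1)) (Fin (n + 1)) ℂ}
    {F : Fin (n + 1) → Fin (n + 1) → ℂ} (hF : IsUnit (frameMatrix F))
    (h : ∀ i, M *ᵥ F i = M' *ᵥ F i) : M = M' := by
  refine hF.mul_right_cancel ?_
  ext i j
  exact congrFun (h j) i

theorem charpoly_eq_prod {M : Matrix (Fin (n + 1)) (Fin (n + 1)) ℂ}
    {F : Fin (n + 1) → Fin (n + 1) → ℂ} {ev : Fin (n + 1) → ℂ} (hF : IsUnit (frameMatrix F))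
    (h : ∀ i, M *ᵥ F i = ev i • F i) :
    M.charpoly =
      ((Finset.univ.val.map ev).map fun t => Polynomial.X - Polynomial.C t).prod := by
  obtain ⟨u, hu⟩ := hF
  have h1 := mul_frameMatrix_eq h
  rw [← hu] at h1
  have h2 : M = u * Matrix.diagonal ev * (u⁻¹ : (Matrix _ _ ℂ)ˣ) := by
    rw [← h1, mul_assoc, Units.mul_inv, mul_one]
  rw [h2, Matrix.coe_units_inv, Matrix.charpoly_units_conj, Matrix.charpoly_diagonal,
    Multiset.map_map]
  rfl

theorem trace_pow_eq_sum {M : Matrix (Fin (n + 1)) (Fin (n + 1)) ℂ}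
    {F : Fin (n + 1) → Fin (n + 1) → ℂ} {ev : Fin (n + 1) → ℂ} (hF : IsUnit (frameMatrix F))
    (h : ∀ i, M *ᵥ F i = ev i • F i) (k : ℕ) : (M ^ k).trace = ∑ i, ev i ^ k := by
  have hk : ∀ i, (M ^ k) *ᵥ F i = (ev i ^ k) • F i := fun i => by
    induction k with
    | zero => simp
    | succ k ih =>
      rw [pow_succ', ← Matrix.mulVec_mulVec, ih, Matrix.mulVec_smul, h, smul_smul, pow_succ]
  obtain ⟨u, hu⟩ := hF
  have h1 := mul_frameMatrix_eq (ev := fun i => ev i ^ k) hk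
  rw [← hu] at h1
  have h2 : M ^ k = u * Matrix.diagonal (fun i => ev i ^ k) * (u⁻¹ : (Matrix _ _ ℂ)ˣ) := by
    rw [← h1, mul_assoc, Units.mul_inv, mul_one]
  rw [h2, Matrix.trace_units_conj, Matrix.trace_diagonal]

/-- The eigenvalues of a diagonalizable element of `SU(n,1)` are determined by half of its
power traces. -/
theorem eigenvalues_eq_of_traces (hn : 1 ≤ n) {A A' : SU n}
    {F F' : Fin (n + 1) → Fin (n + 1) → ℂ} {ev ev' : Fin (n + 1) → ℂ}
    (hF : IsUnit (frameMatrix F)) (hF' : IsUnit (frameMatrix F'))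
    (h : ∀ i, toMat A *ᵥ F i = ev i • F i) (h' : ∀ i, toMat A' *ᵥ F' i = ev' i • F' i)
    (htr : ∀ i, 1 ≤ i → i ≤ (n + 1) / 2 → (toMat A ^ i).trace = (toMat A' ^ i).trace) :
    Finset.univ.val.map ev = Finset.univ.val.map ev' := by
  have hes := esymm_eq_of_power_sums (f := ev) (g := ev') (m := (n + 1) / 2) fun i hi hi' => by
    rw [← trace_pow_eq_sum hF h, ← trace_pow_eq_sum hF' h', htr i hi hi']
  have hcard : ∀ u : Fin (n + 1) → ℂ, Multiset.card (Finset.univ.val.map u) = n + 1 := by simp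
  have hhigh : ∀ k ≤ (n + 1) / 2,
      (toMat A).charpoly.coeff (n + 1 - k) = (toMat A').charpoly.coeff (n + 1 - k) := fun k hk => by
    rw [charpoly_eq_prod hF h, charpoly_eq_prod hF' h',
      Multiset.prod_X_sub_C_coeff _ (by rw [hcard]; omega),
      Multiset.prod_X_sub_C_coeff _ (by rw [hcard]; omega), hcard, hcard,
      Nat.sub_sub_self (by omega), hes k hk]
  have hchar : (toMat A).charpoly = (toMat A').charpoly := by
    ext k
    rcases lt_or_ge (n + 1) k with hk | hk
    · rw [Polynomial.coeff_eq_zero_of_natDegree_lt, Polynomial.coeff_eq_zero_of_natDegree_lt] <;>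
        simpa [Matrix.charpoly_natDegree_eq_dim] using hk
    · rcases le_or_gt (n + 1 - k) ((n + 1) / 2) with hk' | hk'
      · simpa [Nat.sub_sub_self hk] using hhigh _ hk'
      -- Here `k ≤ (n + 1) / 2`, so conjugation turns this low coefficient into a high one that is
      -- already known.
      · refine star_injective ?_
        rw [star_coeff_charpoly hn A hk, star_coeff_charpoly hn A' hk, hhigh k (by omega)]
  rw [charpoly_eq_prod hF h, charpoly_eq_prod hF' h'] at hchar
  simpa only [Polynomial.roots_multiset_prod_X_sub_C] using congrArg Polynomial.roots hchar

/-! ### The type and the ordering determine the eigenvalue list -/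

/-- Monotone enumerations of the same multiset of keys agree. -/
theorem comp_eq_of_monotone {N : ℕ} {f g : Fin N → ℂ}
    (h : Finset.univ.val.map f = Finset.univ.val.map g) (key : ℂ → ℝ)
    (hf : Monotone (key ∘ f)) (hg : Monotone (key ∘ g)) : key ∘ f = key ∘ g := by
  refine List.ofFn_injective (List.Perm.eq_of_pairwise' (r := (· ≤ ·))
    hf.sortedLE_ofFn.pairwise hg.sortedLE_ofFn.pairwise ?_)
  rw [Fin.univ_val_map, Fin.univ_val_map, Multiset.coe_eq_coe] at h
  rw [← List.map_ofFn, ← List.map_ofFn]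
  exact h.map key

theorem exists_eq_of_map_eq {N : ℕ} {f g : Fin N → ℂ}
    (h : Finset.univ.val.map f = Finset.univ.val.map g) (i : Fin N) : ∃ j, g i = f j := by
  have : g i ∈ Finset.univ.val.map f := h ▸ Multiset.mem_map_of_mem g (Finset.mem_univ i)
  obtain ⟨j, -, hj⟩ := Multiset.mem_map.mp this
  exact ⟨j, hj.symm⟩

/-- Both positions count members of one multiset below a threshold. Raising the threshold from `arg
(ev 0)` to `arg (ev' 0)` adds at least `ev 0` itself, so equal positions force equal arguments. -/
theorem negativePosition_lt {ev ev' : Fin (n + 1) → ℂ}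
    (h : Finset.univ.val.map ev = Finset.univ.val.map ev') (hlt : (ev 0).arg < (ev' 0).arg) :
    negativePosition ev < negativePosition ev' := by
  have h1 : negativePosition ev' =
      (Finset.univ.filter fun i => (ev i).arg < (ev' 0).arg).card := by
    have hc : ∀ u : Fin (n + 1) → ℂ, (Finset.univ.filter fun i => (u i).arg < (ev' 0).arg).card =
        (Finset.univ.val.map u).countP fun z => z.arg < (ev' 0).arg := fun u => by
      rw [Multiset.countP_map]; rfl
    rw [negativePosition, hc, hc, h]
  rw [h1, negativePosition]
  refine Finset.card_lt_card (Finset.ssubset_iff_of_subset ?_ |>.mpr ⟨0, ?_, ?_⟩)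
  · intro i
    simp only [Finset.mem_filter, Finset.mem_univ, true_and]
    exact fun hi => hi.trans hlt
  · simpa using hlt
  · simp

theorem eq_of_arg_eq_of_norm_eq_one {z w : ℂ} (hz : ‖z‖ = 1) (hw : ‖w‖ = 1)
    (h : z.arg = w.arg) : z = w :=
  Complex.ext_norm_arg (hz.trans hw.symm) h

/-- Gram matrix of an elliptic frame. -/
theorem IsEllipticFrame.gram_sq :
    (Matrix.diagonal fun i : Fin (n + 1) => if i = 0 then (-1 : ℂ) else 1) *
      (Matrix.diagonal fun i : Fin (n + 1) => if i = 0 then (-1 : ℂ) else 1) = 1 := by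
  rw [Matrix.diagonal_mul_diagonal, ← Matrix.diagonal_one]
  congr 1
  ext i
  split_ifs <;> simp

theorem IsEllipticFrame.isUnit_frameMatrix {A : SU n} {ev F} (h : IsEllipticFrame A ev F) :
    IsUnit (frameMatrix F) :=
  ComplexHyperbolic.isUnit_frameMatrix gram_sq fun i j => by
    rw [h.gram, Matrix.diagonal_apply]

theorem IsHyperbolicFrame.isUnit_frameMatrix (hn : 1 ≤ n) {A : SU n} {ev F}
    (h : IsHyperbolicFrame A ev F) : IsUnit (frameMatrix F) :=
  ComplexHyperbolic.isUnit_frameMatrix (siegelForm_mul_self hn) h.gram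

theorem IsEllipticFrame.norm_eq_one {A : SU n} {ev F} (h : IsEllipticFrame A ev F)
    (i : Fin (n + 1)) : ‖ev i‖ = 1 := by
  refine norm_eq_one_of_mul_star (mul_star_eq_one_of_herm_ne_zero (h.eigen i) (h.eigen i) ?_)
  rw [h.gram]
  split_ifs <;> simp_all

theorem IsEllipticFrame.monotone_key {A : SU n} {ev F} (h : IsEllipticFrame A ev F) :
    Monotone ((fun z : ℂ => if z = ev 0 then -4 else z.arg) ∘ ev) := by
  intro i j hij
  have h1 := Complex.neg_pi_lt_arg (ev j)
  have h2 := Real.pi_lt_four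
  by_cases hi : ev i = ev 0
  · by_cases hj : ev j = ev 0
    · simp [hi, hj]
    · simp only [Function.comp_apply, hi, hj, if_true, if_false]; linarith
  · simpa only [Function.comp_apply, hi, mt (h.negative_first i j hij) hi, if_false]
      using h.sorted i j hij hi

/-- The position recovers the negative eigenvalue. Both lists are then sorted by the same key, which
separates numbers of modulus one because `-4` is not an argument. -/
theorem IsEllipticFrame.eigenvalues_unique {A A' : SU n} {ev ev' F F'}
    (h : IsEllipticFrame A ev F) (h' : IsEllipticFrame A' ev' F')
    (hev : Finset.univ.val.map ev = Finset.univ.val.map ev')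
    (hpos : negativePosition ev = negativePosition ev') : ev = ev' := by
  have h0 : ev 0 = ev' 0 := by
    refine eq_of_arg_eq_of_norm_eq_one (h.norm_eq_one 0) (h'.norm_eq_one 0) ?_
    rcases lt_trichotomy (ev 0).arg (ev' 0).arg with hlt | heq | hlt
    · exact absurd hpos (negativePosition_lt hev hlt).ne
    · exact heq
    · exact absurd hpos (negativePosition_lt hev.symm hlt).ne'
  have hkey := comp_eq_of_monotone hev _ h.monotone_key (h0 ▸ h'.monotone_key)
  ext1 i
  have hi := congrFun hkey i
  have h1 := Complex.neg_pi_lt_arg (ev i)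
  have h1' := Complex.neg_pi_lt_arg (ev' i)
  have h2 := Real.pi_lt_four
  simp only [Function.comp_apply] at hi
  split_ifs at hi with hz hz' hz'
  · exact hz.trans hz'.symm
  · linarith
  · linarith
  · exact eq_of_arg_eq_of_norm_eq_one (h.norm_eq_one i) (h'.norm_eq_one i) hi

theorem IsHyperbolicFrame.mul_star_last {A : SU n} {ev F}
    (h : IsHyperbolicFrame A ev F) : ev 0 * star (ev (Fin.last n)) = 1 := by
  refine mul_star_eq_one_of_herm_ne_zero (h.eigen 0) (h.eigen _) ?_
  rw [h.gram]
  simp [siegelForm]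

theorem IsHyperbolicFrame.norm_last {A : SU n} {ev F}
    (h : IsHyperbolicFrame A ev F) : ‖ev (Fin.last n)‖ < 1 := by
  have h2 := congrArg norm (h.mul_star_last)
  rw [norm_mul, norm_star, norm_one] at h2
  nlinarith [h.attracting, norm_nonneg (ev (Fin.last n))]

theorem IsHyperbolicFrame.norm_eq_one {A : SU n} {ev F}
    (h : IsHyperbolicFrame A ev F) {i : Fin (n + 1)} (h0 : i ≠ 0) (hl : i ≠ Fin.last n) :
    ‖ev i‖ = 1 := by
  refine norm_eq_one_of_mul_star (mul_star_eq_one_of_herm_ne_zero (h.eigen i) (h.eigen i) ?_)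
  rw [h.gram]
  simp [siegelForm, h0, hl]

/-- A sorting key putting the attracting eigenvalue first and the repelling one last. -/
noncomputable def hyperbolicKey (z : ℂ) : ℝ := if 1 < ‖z‖ then -4 else if ‖z‖ < 1 then 4 else z.arg

theorem IsHyperbolicFrame.monotone_key {A : SU n} {ev F}
    (h : IsHyperbolicFrame A ev F) : Monotone (hyperbolicKey ∘ ev) := by
  have hb : ∀ z, -4 ≤ hyperbolicKey z ∧ hyperbolicKey z ≤ 4 := fun z => by
    have h1 := Complex.neg_pi_lt_arg z
    have h1' := Complex.arg_le_pi z
    have h2 := Real.pi_lt_four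
    unfold hyperbolicKey
    split_ifs <;> constructor <;> linarith
  intro i j hij
  rcases eq_or_ne i 0 with rfl | hi
  · have : hyperbolicKey (ev 0) = -4 := if_pos h.attracting
    exact this.trans_le (hb _).1
  rcases eq_or_ne j (Fin.last n) with rfl | hj
  · have hl := h.norm_last
    have : hyperbolicKey (ev (Fin.last n)) = 4 := by
      rw [hyperbolicKey, if_neg hl.le.not_gt, if_pos hl]
    exact (hb _).2.trans_eq this.symm
  · have hi0 := Fin.pos_iff_ne_zero.mpr hi
    have hjl := Fin.lt_last_iff_ne_last.mpr hj
    have h1 := h.norm_eq_one hi (hij.trans_lt hjl).ne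
    have h2 := h.norm_eq_one (hi0.trans_le hij).ne' hj
    simpa [hyperbolicKey, h1, h2] using h.sorted i j hi0 hij hjl

/-- The attracting eigenvalue is the only one of modulus above `1`, and the repelling one is its
conjugate inverse. The others have modulus one and are sorted by argument. -/
theorem IsHyperbolicFrame.eigenvalues_unique {A A' : SU n} {ev ev' F F'}
    (h : IsHyperbolicFrame A ev F) (h' : IsHyperbolicFrame A' ev' F')
    (hev : Finset.univ.val.map ev = Finset.univ.val.map ev') : ev = ev' := by
  have h0 : ev 0 = ev' 0 := by
    obtain ⟨j, hj⟩ := exists_eq_of_map_eq hev 0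
    have h1 := h'.attracting
    rw [hj] at h1
    rcases eq_or_ne j 0 with rfl | hj0
    · exact hj.symm
    rcases eq_or_ne j (Fin.last n) with rfl | hjl
    · exact absurd h1 (h.norm_last).le.not_gt
    · exact absurd h1 (h.norm_eq_one hj0 hjl).le.not_gt
  have hkey := comp_eq_of_monotone hev _ (h.monotone_key) (h'.monotone_key)
  ext1 i
  rcases eq_or_ne i 0 with rfl | hi0
  · exact h0
  rcases eq_or_ne i (Fin.last n) with rfl | hil
  · have h1 := h.mul_star_last
    have h2 := h'.mul_star_last
    rw [← h0, ← h1] at h2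
    exact star_injective (mul_left_cancel₀ (left_ne_zero_of_mul_eq_one h1) h2).symm
  · have h1 := h.norm_eq_one hi0 hil
    have h2 := h'.norm_eq_one hi0 hil
    refine eq_of_arg_eq_of_norm_eq_one h1 h2 ?_
    simpa [hyperbolicKey, h1, h2] using congrFun hkey i

/-! ### Points of the closure of hyperbolic space -/

theorem herm_mk_rep_nonpos {v : Fin (n + 1) → ℂ} (hv : v ≠ 0) (h : (herm n v v).re ≤ 0) :
    (herm n (Projectivization.mk ℂ v hv).rep (Projectivization.mk ℂ v hv).rep).re ≤ 0 := by
  obtain ⟨c, hc⟩ := Projectivization.exists_smul_eq_mk_rep ℂ v hv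
  rw [← hc, Units.smul_def, herm_smul_smul_self]
  exact mul_nonpos_of_nonneg_of_nonpos (sq_nonneg _) h

theorem exists_closedHyp {v : Fin (n + 1) → ℂ} (hv : v ≠ 0) (h : (herm n v v).re ≤ 0) :
    ∃ p : ClosedHyp n, p.1.submodule = Submodule.span ℂ {v} :=
  ⟨⟨Projectivization.mk ℂ v hv, herm_mk_rep_nonpos hv h⟩, Projectivization.submodule_mk v hv⟩

theorem smul_submodule (g : SU n) {p : ℙ ℂ (Fin (n + 1) → ℂ)} {v : Fin (n + 1) → ℂ}
    (hp : p.submodule = Submodule.span ℂ {v}) :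
    (g • p).submodule = Submodule.span ℂ {toMat g *ᵥ v} := by
  have hv : v ≠ 0 := by
    rintro rfl
    have h := p.submodule_eq ▸ Submodule.mem_span_singleton_self (R := ℂ) p.rep
    rw [hp, Submodule.span_zero_singleton, Submodule.mem_bot] at h
    exact p.rep_nonzero h
  obtain rfl : p = Projectivization.mk ℂ v hv :=
    Projectivization.submodule_injective (hp.trans (Projectivization.submodule_mk v hv).symm)
  have hg : g • v ≠ 0 := (smul_ne_zero_iff_ne g).mpr hv
  have h : g • Projectivization.mk ℂ v hv = Projectivization.mk ℂ (g • v) hg :=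
    Projectivization.smul_mk g hv
  rw [h, Projectivization.submodule_mk, smul_eq_toMat_mulVec]

/-- The action of `SU(n,1)` on the closure of hyperbolic space. -/
noncomputable def ClosedHyp.translate (g : SU n) (p : ClosedHyp n) : ClosedHyp n :=
  ⟨g • p.1, by
    have hg : g • p.1.rep ≠ 0 := (smul_ne_zero_iff_ne g).mpr p.1.rep_nonzero
    have h : g • p.1 = Projectivization.mk ℂ (g • p.1.rep) hg := by
      conv_lhs => rw [← p.1.mk_rep]
      exact Projectivization.smul_mk g p.1.rep_nonzero
    rw [h]
    refine herm_mk_rep_nonpos hg ?_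
    rw [smul_eq_toMat_mulVec, herm_toMat_mulVec]
    exact p.2⟩

/-! ### Existence of associated points -/

theorem IsEllipticFrame.herm_lift_self {A : SU n} {ev F} (h : IsEllipticFrame A ev F)
    (i : Fin (n + 1)) : herm n (ellipticLift F i) (ellipticLift F i) = -1 := by
  have h2 : ((√2 : ℝ) : ℂ) * ((√2 : ℝ) : ℂ) = 2 := by
    rw [← Complex.ofReal_mul, Real.mul_self_sqrt (by norm_num)]; norm_num
  rcases eq_or_ne i 0 with rfl | hi
  · simp [ellipticLift, h.gram]
  · simp only [ellipticLift, hi, if_false, herm_add_left, herm_add_right, herm_smul_left,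
      herm_smul_right, h.gram, hi.symm]
    simp only [if_true, RCLike.star_def, Complex.conj_ofReal]
    linear_combination -h2

/-- For the middle lifts, `(a - r)/√2` has square `-1`, which cancels the `+1` of `x_l`. The points
lie on the boundary, so nonvanishing of the lifts needs a separate proof. -/
theorem IsHyperbolicFrame.herm_lift_self {A : SU n} {ev F}
    (h : IsHyperbolicFrame A ev F) (hn : 1 ≤ n) (i : Fin (n + 1)) :
    herm n (hyperbolicLift F i) (hyperbolicLift F i) = 0 := by
  have h0 := zero_ne_last hn
  have h2 : (((√2)⁻¹ : ℝ) : ℂ) * (((√2)⁻¹ : ℝ) : ℂ) * 2 = 1 := by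
    rw [← Complex.ofReal_mul, ← mul_inv, Real.mul_self_sqrt (by norm_num)]; norm_num
  rcases eq_or_ne i 0 with rfl | hi
  · simp [hyperbolicLift, h.gram, siegelForm, h0]
  rcases eq_or_ne i (Fin.last n) with rfl | hl
  · simp [hyperbolicLift, h.gram, siegelForm, hi]
  · simp only [hyperbolicLift, hi, hl, if_false, herm_add_left, herm_add_right, herm_smul_left,
      herm_smul_right, herm_sub_left, herm_sub_right, h.gram, siegelForm, Matrix.of_apply, hi.symm,
      hl.symm, h0, h0.symm]
    simp only [if_true, RCLike.star_def, Complex.conj_ofReal]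
    linear_combination -h2

theorem IsHyperbolicFrame.lift_ne_zero {A : SU n} {ev F}
    (h : IsHyperbolicFrame A ev F) (hn : 1 ≤ n) (i : Fin (n + 1)) : hyperbolicLift F i ≠ 0 := by
  have h0 := zero_ne_last hn
  intro hz
  rcases eq_or_ne i 0 with rfl | hi
  · have := congrArg (herm n · (F (Fin.last n))) hz
    simp [hyperbolicLift, h.gram, siegelForm] at this
    simp [herm] at this
  rcases eq_or_ne i (Fin.last n) with rfl | hl
  · have := congrArg (herm n · (F 0)) hz
    simp [hyperbolicLift, h.gram, siegelForm, hi] at this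
    simp [herm] at this
  · have := congrArg (herm n · (F i)) hz
    simp [hyperbolicLift, herm_add_left, herm_sub_left, herm_smul_left, h.gram, siegelForm, hi, hl]
      at this
    simp [herm] at this

theorem exists_isAssociated (hn : 1 ≤ n) {A : SU n} (hA : IsSemisimpleElt A) :
    ∃ t p, IsAssociated A t p := by
  by_cases hell : ∀ (μ : ℂ) v, v ≠ 0 → toMat A *ᵥ v = μ • v → ‖μ‖ ≤ 1
  · obtain ⟨ev, F, h⟩ := exists_ellipticFrame hn hA hell
    choose p hp using fun i => exists_closedHyp (v := ellipticLift F i)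
      (by intro hz; have := h.herm_lift_self i; simp [hz, herm] at this)
      (by rw [h.herm_lift_self]; simp)
    exact ⟨_, p, Or.inr ⟨ev, F, h, rfl, hp⟩⟩
  · push Not at hell
    obtain ⟨μ, v, hv, hμ, hlt⟩ := hell
    obtain ⟨ev, F, h⟩ := exists_hyperbolicFrame hn hA hv hμ hlt
    choose p hp using fun i => exists_closedHyp (h.lift_ne_zero hn i)
      (by rw [h.herm_lift_self hn]; simp)
    exact ⟨_, p, Or.inl ⟨ev, F, h, rfl, hp⟩⟩

/-! ### Conjugation invariance -/

theorem toMat_conj_mulVec (g A : SU n) (v : Fin (n + 1) → ℂ) :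
    toMat (g * A * g⁻¹) *ᵥ (toMat g *ᵥ v) = toMat g *ᵥ (toMat A *ᵥ v) := by
  rw [Matrix.mulVec_mulVec, Matrix.mulVec_mulVec, ← toMat_mul, ← toMat_mul, inv_mul_cancel_right]

theorem IsAssociated.conj {A : SU n} {t p} (h : IsAssociated A t p) (g : SU n) :
    IsAssociated (g * A * g⁻¹) t fun i => (p i).translate g := by
  have heig : ∀ {F : Fin (n + 1) → Fin (n + 1) → ℂ} {ev : Fin (n + 1) → ℂ},
      (∀ i, toMat A *ᵥ F i = ev i • F i) →
      ∀ i, toMat (g * A * g⁻¹) *ᵥ (toMat g *ᵥ F i) = ev i • toMat g *ᵥ F i := fun hF i => by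
    rw [toMat_conj_mulVec, hF, Matrix.mulVec_smul]
  rcases h with ⟨ev, F, hF, ht, hp⟩ | ⟨ev, F, hF, ht, hp⟩
  · refine Or.inl ⟨ev, fun i => toMat g *ᵥ F i,
      ⟨fun i j => by rw [herm_toMat_mulVec, hF.gram], heig hF.eigen, hF.attracting, hF.sorted⟩,
      ht, fun i => (smul_submodule g (hp i)).trans ?_⟩
    congr 2
    unfold hyperbolicLift
    split_ifs <;> simp [Matrix.mulVec_add, Matrix.mulVec_smul, Matrix.mulVec_sub]
  · refine Or.inr ⟨ev, fun i => toMat g *ᵥ F i,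
      ⟨fun i j => by rw [herm_toMat_mulVec, hF.gram], heig hF.eigen, hF.negative_first,
        hF.sorted⟩, ht, fun i => (smul_submodule g (hp i)).trans ?_⟩
    congr 2
    unfold ellipticLift
    split_ifs <;> simp [Matrix.mulVec_add, Matrix.mulVec_smul]

theorem canonicalOrbit_subset_conj (g A B : SU n) :
    canonicalOrbit A B ⊆ canonicalOrbit (g * A * g⁻¹) (g * B * g⁻¹) := by
  rintro c ⟨s, t, p, q, hp, hq, rfl⟩
  refine ⟨s, t, _, _, hp.conj g, hq.conj g, ?_⟩
  have h : Quotient.mk (congSetoid n) (p, q) = Quotient.mk (congSetoid n)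
      (fun i => (p i).translate g, fun i => (q i).translate g) :=
    Quotient.sound ⟨g, fun _ => rfl, fun _ => rfl⟩
  exact congrArg (fun x : ConfigSpace n => (s, t, x)) h

theorem canonicalOrbit_conj (g A B : SU n) :
    canonicalOrbit (g * A * g⁻¹) (g * B * g⁻¹) = canonicalOrbit A B := by
  refine (canonicalOrbit_subset_conj g A B).antisymm' ?_
  have h := canonicalOrbit_subset_conj g⁻¹ (g * A * g⁻¹) (g * B * g⁻¹)
  have hc : ∀ C : SU n, g⁻¹ * (g * C * g⁻¹) * g⁻¹⁻¹ = C := fun C => by group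
  rwa [hc, hc] at h

theorem trace_pow_conj (g A : SU n) (i : ℕ) :
    (toMat (g * A * g⁻¹) ^ i).trace = (toMat A ^ i).trace := by
  have hpow : ∀ (C : SU n), toMat (C ^ i) = toMat C ^ i := fun C => by
    induction i with
    | zero => rfl
    | succ i ih => rw [pow_succ, toMat_mul, ih, pow_succ]
  rw [← hpow, conj_pow, toMat_mul, Matrix.trace_mul_comm, ← toMat_mul, ← mul_assoc,
    inv_mul_cancel, one_mul, hpow]

/-! ### Rigidity of associated points -/

theorem exists_smul_lift {g : SU n} {p p' : ℙ ℂ (Fin (n + 1) → ℂ)} {v v' : Fin (n + 1) → ℂ}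
    (hp : p.submodule = Submodule.span ℂ {v}) (hp' : p'.submodule = Submodule.span ℂ {v'})
    (hg : g • p = p') : ∃ c : ℂ, toMat g *ᵥ v = c • v' := by
  have h := smul_submodule g hp
  rw [hg, hp'] at h
  have hm : toMat g *ᵥ v ∈ Submodule.span ℂ {v'} := h ▸ Submodule.mem_span_singleton_self _
  obtain ⟨c, hc⟩ := Submodule.mem_span_singleton.mp hm
  exact ⟨c, hc.symm⟩

/-- If `g w = d w'`, then `g` maps the orthogonal complement of `w` to that of `w'`. -/
theorem herm_mulVec_eq_zero {g : SU n} {z w w' : Fin (n + 1) → ℂ} {d : ℂ}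
    (hw : toMat g *ᵥ w = d • w') (hw0 : w ≠ 0) (h : herm n z w = 0) :
    herm n (toMat g *ᵥ z) w' = 0 := by
  have h1 := herm_toMat_mulVec g z w
  rw [hw, herm_smul_right, h] at h1
  refine (mul_eq_zero.mp h1).resolve_left fun hd => hw0 (toMat_mulVec_injective g ?_)
  simpa [star_eq_zero.mp hd] using hw

/-- The line of `x₁` goes to that of `x₁'`, so `x_j` goes into the complement of `x₁'`. Comparing
`x₁'`-components of the images of `√2 x₁ + x_j` forces the scalar on this lift to equal the one on
`x₁`, and subtraction leaves `x_j`. -/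
theorem IsEllipticFrame.exists_smul {A A' g : SU n} {ev ev' F F'} (h : IsEllipticFrame A ev F)
    (h' : IsEllipticFrame A' ev' F')
    (hg : ∀ i, ∃ c : ℂ, toMat g *ᵥ ellipticLift F i = c • ellipticLift F' i) (i : Fin (n + 1)) :
    ∃ c : ℂ, toMat g *ᵥ F i = c • F' i := by
  obtain ⟨d, hd⟩ := hg 0
  simp only [ellipticLift, if_true] at hd
  rcases eq_or_ne i 0 with rfl | hi
  · exact ⟨d, hd⟩
  have hF0 : F 0 ≠ 0 := by
    intro hz; have := h.gram 0 0; simp [hz, herm] at this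
  obtain ⟨c, hc⟩ := hg i
  simp only [ellipticLift, hi, if_false, Matrix.mulVec_add, Matrix.mulVec_smul, hd, smul_add] at hc
  have horth : herm n (toMat g *ᵥ F i) (F' 0) = 0 :=
    herm_mulVec_eq_zero hd hF0 (by simp [h.gram, hi])
  have hs : ((√2 : ℝ) : ℂ) ≠ 0 := by simp
  have h1 := congrArg (herm n · (F' 0)) hc
  simp only [herm_add_left, herm_smul_left, horth, h'.gram, hi, if_true, if_false] at h1
  have hdc : d = c := mul_left_cancel₀ hs (by linear_combination -h1)
  refine ⟨c, ?_⟩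
  rw [hdc, smul_comm] at hc
  exact add_left_cancel hc

theorem IsHyperbolicFrame.exists_smul (hn : 1 ≤ n) {A A' g : SU n} {ev ev' F F'}
    (h : IsHyperbolicFrame A ev F) (h' : IsHyperbolicFrame A' ev' F')
    (hg : ∀ i, ∃ c : ℂ, toMat g *ᵥ hyperbolicLift F i = c • hyperbolicLift F' i)
    (i : Fin (n + 1)) : ∃ c : ℂ, toMat g *ᵥ F i = c • F' i := by
  have h0 := zero_ne_last hn
  obtain ⟨α, hα⟩ := hg 0
  obtain ⟨β, hβ⟩ := hg (Fin.last n)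
  simp only [hyperbolicLift, if_true, h0.symm, if_false] at hα hβ
  rcases eq_or_ne i 0 with rfl | hi
  · exact ⟨α, hα⟩
  rcases eq_or_ne i (Fin.last n) with rfl | hl
  · exact ⟨β, hβ⟩
  have hF0 : F 0 ≠ 0 := by
    intro hz; have := h.gram 0 (Fin.last n); simp [hz, herm, siegelForm] at this
  have hFl : F (Fin.last n) ≠ 0 := by
    intro hz; have := h.gram (Fin.last n) 0; simp [hz, herm, siegelForm, h0.symm] at this
  obtain ⟨c, hc⟩ := hg i
  simp only [hyperbolicLift, hi, hl, if_false, Matrix.mulVec_add, Matrix.mulVec_smul,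
    Matrix.mulVec_sub, hα, hβ, smul_add] at hc
  have hgram : ∀ j k, herm n (F' j) (F' k) = siegelForm n j k := h'.gram
  have horth0 : herm n (toMat g *ᵥ F i) (F' 0) = 0 :=
    herm_mulVec_eq_zero hα hF0 (by simp [h.gram, siegelForm, hi, hl])
  have horthl : herm n (toMat g *ᵥ F i) (F' (Fin.last n)) = 0 :=
    herm_mulVec_eq_zero hβ hFl (by simp [h.gram, siegelForm, hi, hl])
  have hs : (((√2)⁻¹ : ℝ) : ℂ) ≠ 0 := by simp
  -- Pairing with `a'` reads off the `r'`-component and pairing with `r'` the `a'`-component, so `β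
  -- = c` and `α = c`.
  have h1 := congrArg (herm n · (F' 0)) hc
  have h2 := congrArg (herm n · (F' (Fin.last n))) hc
  simp only [herm_add_left, herm_sub_left, herm_smul_left, horth0, horthl, hgram, siegelForm,
    Matrix.of_apply, hi, hl, h0, h0.symm, if_true, if_false] at h1 h2
  have hβc : β = c := mul_left_cancel₀ hs (by linear_combination -h1)
  have hαc : α = c := mul_left_cancel₀ hs (by linear_combination h2)
  refine ⟨c, ?_⟩
  rw [hαc, hβc, ← smul_sub, smul_comm] at hc
  exact add_left_cancel hc

/-- An element of `SU(n,1)` mapping eigenlines to eigenlines with the same eigenvalues is a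
conjugation. -/
theorem eq_conj_of_eigenlines {A A' g : SU n} {F F' : Fin (n + 1) → Fin (n + 1) → ℂ}
    {ev : Fin (n + 1) → ℂ} (hF : IsUnit (frameMatrix F)) (h : ∀ i, toMat A *ᵥ F i = ev i • F i)
    (h' : ∀ i, toMat A' *ᵥ F' i = ev i • F' i) (hg : ∀ i, ∃ c : ℂ, toMat g *ᵥ F i = c • F' i) :
    A' = g * A * g⁻¹ := by
  refine eq_mul_inv_of_mul_eq (toMat_injective (eq_of_mulVec_eq_on_frame hF fun i => ?_))
  obtain ⟨c, hc⟩ := hg i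
  rw [toMat_mul, toMat_mul, ← Matrix.mulVec_mulVec, ← Matrix.mulVec_mulVec, h, Matrix.mulVec_smul,
    hc, Matrix.mulVec_smul, h', smul_comm]

/-- The common type rules out the mixed hyperbolic/elliptic cases and, with the traces, makes the
two eigenvalue lists equal; `g` then matches eigenlines with equal eigenvalues. -/
theorem IsAssociated.eq_conj (hn : 1 ≤ n) {A A' g : SU n} {t p p'} (h : IsAssociated A t p)
    (h' : IsAssociated A' t p') (hg : ∀ i, g • (p i).1 = (p' i).1)
    (htr : ∀ i, 1 ≤ i → i ≤ (n + 1) / 2 → (toMat A ^ i).trace = (toMat A' ^ i).trace) :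
    A' = g * A * g⁻¹ := by
  rcases h with ⟨ev, F, hF, rfl, hp⟩ | ⟨ev, F, hF, rfl, hp⟩ <;>
    rcases h' with ⟨ev', F', hF', ht, hp'⟩ | ⟨ev', F', hF', ht, hp'⟩
  · obtain rfl := hF.eigenvalues_unique hF' (eigenvalues_eq_of_traces hn
      (hF.isUnit_frameMatrix hn) (hF'.isUnit_frameMatrix hn) hF.eigen hF'.eigen htr)
    exact eq_conj_of_eigenlines (hF.isUnit_frameMatrix hn) hF.eigen hF'.eigen
      (hF.exists_smul hn hF' fun i => exists_smul_lift (hp i) (hp' i) (hg i))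
  · simp at ht
  · simp at ht
  · obtain rfl := hF.eigenvalues_unique hF' (eigenvalues_eq_of_traces hn
      hF.isUnit_frameMatrix hF'.isUnit_frameMatrix hF.eigen hF'.eigen htr) (Option.some.inj ht)
    exact eq_conj_of_eigenlines hF.isUnit_frameMatrix hF.eigen hF'.eigen
      (hF.exists_smul hF' fun i => exists_smul_lift (hp i) (hp' i) (hg i))

/-! ### From the two generators to the representations -/

theorem charClass_eq_of_generators {ρ ρ' : FreeGroup (Fin 2) →* SU n} {g : SU n}
    (h0 : ρ' (FreeGroup.of 0) = g * ρ (FreeGroup.of 0) * g⁻¹)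
    (h1 : ρ' (FreeGroup.of 1) = g * ρ (FreeGroup.of 1) * g⁻¹) : charClass ρ = charClass ρ' := by
  refine Quotient.sound ⟨g, fun w => ?_⟩
  have : ρ' = (MulAut.conj g).toMonoidHom.comp ρ := by
    ext1 i
    fin_cases i
    · exact h0
    · exact h1
  rw [this]
  rfl

end ComplexHyperbolic

open ComplexHyperbolic

theorem mainTheorem3 (n : ℕ) (hn : 1 ≤ n)
    (ρ ρ' : FreeGroup (Fin 2) →* ComplexHyperbolic.SU n)
    (hρ : ComplexHyperbolic.IsSemisimpleRep ρ) (hρ' : ComplexHyperbolic.IsSemisimpleRep ρ') :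
    ComplexHyperbolic.charClass ρ = ComplexHyperbolic.charClass ρ' ↔
      (∀ i : ℕ, 1 ≤ i → i ≤ (n + 1) / 2 →
        (ComplexHyperbolic.toMat (ρ (FreeGroup.of 0)) ^ i).trace =
            (ComplexHyperbolic.toMat (ρ' (FreeGroup.of 0)) ^ i).trace ∧
          (ComplexHyperbolic.toMat (ρ (FreeGroup.of 1)) ^ i).trace =
            (ComplexHyperbolic.toMat (ρ' (FreeGroup.of 1)) ^ i).trace) ∧
      ComplexHyperbolic.canonicalOrbit (ρ (FreeGroup.of 0)) (ρ (FreeGroup.of 1)) =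
        ComplexHyperbolic.canonicalOrbit (ρ' (FreeGroup.of 0)) (ρ' (FreeGroup.of 1)) := by
  constructor
  · intro h
    obtain ⟨g, hg⟩ : ∃ g : SU n, ∀ w, ρ' w = g * ρ w * g⁻¹ := Quotient.exact h
    simp only [hg, trace_pow_conj, canonicalOrbit_conj, and_self, implies_true]
  · rintro ⟨htr, horb⟩
    obtain ⟨s, p, hp⟩ := exists_isAssociated hn hρ.1
    obtain ⟨t, q, hq⟩ := exists_isAssociated hn hρ.2
    -- One element of the orbit suffices: equality of orbits realizes its class by eigenframes of
    -- the images under `ρ'`.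
    obtain ⟨s', t', p', q', hp', hq', hc⟩ := horb.subset ⟨s, t, p, q, hp, hq, rfl⟩
    obtain rfl : s = s' := congrArg Prod.fst hc
    obtain rfl : t = t' := congrArg (fun c => c.2.1) hc
    replace hc := congrArg (fun c => c.2.2) hc
    -- The same `g` moves both tuples; congruence of the two tuples separately would give only
    -- separate conjugacies.
    obtain ⟨g, hgp, hgq⟩ : ∃ g : SU n, (∀ i, g • (p i).1 = (p' i).1) ∧
      ∀ i, g • (q i).1 = (q' i).1 := Quotient.exact hc
    exact charClass_eq_of_generators
      (hp.eq_conj hn hp' hgp fun i hi hi' => (htr i hi hi').1)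
      (hq.eq_conj hn hq' hgq fun i hi hi' => (htr i hi hi').2)
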